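/- Let $X$ be a (Hausdorff) complex manifold of pure dimension $n$ satisfying Condition A: there is a global holomorphic frame $\omega=(\omega^1,\dots,\omega^n)$ of the holomorphic cotangent bundle $\mathbf T(X)^*$ over $X$ with $d\omega^j=0$ for $1\le j\le n$. Let $\Omega\Subset X$ be a relatively compact domain (that is, a non-empty connected open subset whose closure in $X$ is compact). Then $\Omega$ is a domain of holomorphy if and only if $\Omega$ is holomorphically convex. Here $\mathcal O(S)$ denotes the set of holomorphic functions on an open set $S\subset X$. The domain $\Omega$ is called a *domain of holomorphy* if there is no boundary point $b\in\partial\Omega$ for which there are a connected open neighbourhood $U$ of $b$ in $X$ and a non-empty open subset $V\subset U\cap\Omega$ such that for every $f\in\mathcal O(\Omega)$ there exists $g\in\mathcal O(U)$ with $f|_V=g|_V$. It is called *holomorphically convex* if for every compact subset $K\subset\Omega$ the hull $$\hat K_\Omega=\Big\{x\in\Omega:\ |f(x)|\le \max_K|f|\ \text{ for all } f\in\mathcal O(\Omega)\Big\}$$ (with $\hat K_\Omega=\emptyset$ for $K=\emptyset$) is relatively compact in $\Omega$. -/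

import Mathlib

open Set
open scoped Manifold ContDiff Topology

noncomputable section

namespace CartanThullen

/-- `A ⋐ S`: the closure of `A` is compact and contained in `S`. -/
def RelCompactIn {X : Type*} [TopologicalSpace X] (A S : Set X) : Prop :=
  IsCompact (closure A) ∧ closure A ⊆ S

/-- The cotangent space at `x` of a manifold `X` modelled on `ℂⁿ`: the `ℂ`-linear forms on the
(holomorphic) tangent space. Mathlib's hom-bundle construction makes this family a vector bundle
with fibre `ℂⁿ →L[ℂ] ℂ`. The norm on `Fin n → ℂ` only serves to define its topology. -/
abbrev Cotangent {n : ℕ} {X : Type*} [TopologicalSpace X] [ChartedSpace (Fin n → ℂ) X]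
    (x : X) : Type :=
  TangentSpace 𝓘(ℂ, Fin n → ℂ) x →L[ℂ] Bundle.Trivial X ℂ x

section Manifold

variable {n : ℕ} {X : Type*} [TopologicalSpace X] [ChartedSpace (Fin n → ℂ) X]

/-- The pull-back of a `(1,0)`-form `η` under the inverse of the preferred chart at `p`. It is a
differential `1`-form on `ℂⁿ`, meaningful on the target of that chart. -/
def formInChart (η : (x : X) → Cotangent (n := n) x) (p : X) (z : Fin n → ℂ) :
    (Fin n → ℂ) [⋀^Fin 1]→L[ℂ] ℂ :=
  ContinuousAlternatingMap.ofSubsingleton ℂ (Fin n → ℂ) ℂ (0 : Fin 1)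
    ((η ((chartAt (Fin n → ℂ) p).symm z)).comp
      (mfderiv 𝓘(ℂ, Fin n → ℂ) 𝓘(ℂ, Fin n → ℂ) (chartAt (Fin n → ℂ) p).symm z))

/-- `dη = 0` on `X`: in every preferred chart the exterior derivative of `η` vanishes. -/
def IsClosedForm (η : (x : X) → Cotangent (n := n) x) : Prop :=
  ∀ p : X, ∀ z ∈ (chartAt (Fin n → ℂ) p).target, extDeriv (formInChart η p) z = 0

variable (n X) in
/-- The holomorphic cotangent bundle of the complex manifold `X` of dimension `n` has a global
holomorphic frame `ω¹, …, ωⁿ` over `X` with `dωʲ = 0` for all `j`. -/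
def CondA [IsManifold 𝓘(ℂ, Fin n → ℂ) ω X] : Prop :=
  ∃ η : Fin n → (x : X) → Cotangent (n := n) x,
    IsLocalFrameOn 𝓘(ℂ, Fin n → ℂ) ((Fin n → ℂ) →L[ℂ] ℂ) ω η univ ∧
    ∀ j, IsClosedForm (η j)

variable (n) in
/-- `f` is holomorphic on the open set `S`. The values of `f` outside `S` play no role, so that
these `f` represent exactly the elements of `𝒪(S)`. -/
def HolomorphicOn (f : X → ℂ) (S : Set X) : Prop :=
  MDifferentiableOn 𝓘(ℂ, Fin n → ℂ) 𝓘(ℂ, ℂ) f S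

variable (n) in
/-- The holomorphically convex hull of `K` in `Ω`:
all `x ∈ Ω` with `|f x| ≤ max_K |f|` for every `f ∈ 𝒪(Ω)`. -/
def holHull (Ω K : Set X) : Set X :=
  {x ∈ Ω | ∀ f : X → ℂ, HolomorphicOn n f Ω → ‖f x‖ ≤ sSup ((fun y => ‖f y‖) '' K)}

variable (n) in
/-- The hull of every compact subset of `Ω` is relatively compact in `Ω`. -/
def HolomorphicallyConvex (Ω : Set X) : Prop :=
  ∀ K : Set X, IsCompact K → K ⊆ Ω → RelCompactIn (holHull n Ω K) Ω

variable (n) in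
/-- There is no boundary point `b` of `Ω` with a connected open neighbourhood `U` and a nonempty
open `V ⊆ U ∩ Ω` such that for every `f ∈ 𝒪(Ω)` there is `g ∈ 𝒪(U)` with `f = g` on `V`. -/
def IsDomainOfHolomorphy (Ω : Set X) : Prop :=
  ¬ ∃ b ∈ frontier Ω, ∃ U V : Set X,
    IsOpen U ∧ IsConnected U ∧ b ∈ U ∧ IsOpen V ∧ V.Nonempty ∧ V ⊆ U ∩ Ω ∧
    ∀ f : X → ℂ, HolomorphicOn n f Ω → ∃ g : X → ℂ, HolomorphicOn n g U ∧ EqOn f g V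

end Manifold

end CartanThullen

end

open Set Filter
open scoped Manifold ContDiff Topology

namespace CartanThullen

/-! ### Holomorphic functions on complex normed spaces. -/

section SeveralVariables

variable {E : Type*} [NormedAddCommGroup E] [NormedSpace ℂ E]

/-! A closed coframe is locally the differential of a coordinate system, by the Poincaré lemma and
the inverse function theorem (`hasFlatCharts_coframeEquiv`). The derivatives along the dual vector
fields are thus operators defined on all of `𝒪(Ω)`, and in flat charts they are ordinary derivatives
in constant directions. This makes the Cartan–Thullen argument of `ℂⁿ` available on `X`.

If the hull of `K` accumulates at a boundary point `b`, take Cauchy estimates on `K` whose radius is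
the same for all `f ∈ 𝒪(Ω)` (`exists_uniform_cauchy_estimate`). The iterated derivatives are again
in `𝒪(Ω)`, so the hull inequality carries the estimates to every hull point `x`. Hence the Taylor
series of `f` at `x` converges on a flat ball whose radius does not depend on `x` or `f`. For `x`
close to `b` this ball contains `b`, so every `f` extends across `b`
(`exists_holomorphic_extension`).

Conversely, suppose that all `f ∈ 𝒪(Ω)` extend from `V` to `U`. A component `W` of `U ∩ Ω` meeting
`V` has a limit point `c ∈ U \ Ω`, and by the identity theorem each `f` is bounded on `W` near `c`.
In a holomorphically convex `Ω`, a set on which every `f` is bounded lies in a compact subset of `Ω`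
(`HolomorphicallyConvex.exists_compact_superset`); otherwise a series of functions with rapidly
growing values yields an unbounded one. This forces `c ∈ Ω`, a contradiction. -/

theorem norm_fderiv_le_of_norm_le {F : E → ℂ} {z : E} {r M : ℝ} (hr : 0 < r)
    (hF : DifferentiableOn ℂ F (Metric.ball z r)) (hM : ∀ w ∈ Metric.ball z r, ‖F w‖ ≤ M) :
    ‖fderiv ℂ F z‖ ≤ 2 * M / r := by
  refine Complex.norm_fderiv_le_div_of_mapsTo_ball hF (fun w hw => ?_) hr
  rw [Metric.mem_closedBall, dist_eq_norm]
  calc ‖F w - F z‖ ≤ ‖F w‖ + ‖F z‖ := norm_sub_le _ _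
    _ ≤ M + M := add_le_add (hM w hw) (hM z (Metric.mem_ball_self hr))
    _ = 2 * M := by ring

/-- **Weierstrass' theorem**: uniform limits of holomorphic functions are holomorphic. -/
theorem differentiableAt_of_tendstoUniformlyOn_ball {F : ℕ → E → ℂ} {f : E → ℂ} {z : E} {r : ℝ}
    (hr : 0 < r) (hF : ∀ k, DifferentiableOn ℂ (F k) (Metric.ball z r))
    (hlim : TendstoUniformlyOn F f atTop (Metric.ball z r)) : DifferentiableAt ℂ f z := by
  have hr2 : 0 < r / 2 := half_pos hr
  have hsub : ∀ w ∈ Metric.ball z (r / 2), Metric.ball w (r / 2) ⊆ Metric.ball z r :=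
    fun w hw => Metric.ball_subset_ball' (by rw [Metric.mem_ball] at hw; linarith)
  have hmem : Metric.ball z (r / 2) ⊆ Metric.ball z r := Metric.ball_subset_ball (by linarith)
  have hat : ∀ k, ∀ w ∈ Metric.ball z r, DifferentiableAt ℂ (F k) w :=
    fun k w hw => (hF k).differentiableAt (Metric.isOpen_ball.mem_nhds hw)
  -- Cauchy's estimate on balls of radius `r / 2` makes the derivatives uniformly Cauchy on the half
  -- ball.
  have hcau : UniformCauchySeqOn (fun k w => fderiv ℂ (F k) w) atTop (Metric.ball z (r / 2)) := by
    rw [Metric.uniformCauchySeqOn_iff]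
    intro ε hε
    have hδ : 0 < ε * r / 8 := by positivity
    obtain ⟨N, hN⟩ := (Metric.uniformCauchySeqOn_iff.1 hlim.uniformCauchySeqOn) _ hδ
    refine ⟨N, fun m hm k hk w hw => ?_⟩
    have h := norm_fderiv_le_of_norm_le (F := fun y => F m y - F k y) (z := w) hr2
      (((hF m).sub (hF k)).mono (hsub w hw)) (M := ε * r / 8) fun y hy => by
        rw [← dist_eq_norm]
        exact (hN m hm k hk y (hsub w hw hy)).le
    rw [fderiv_fun_sub (hat m w (hmem hw)) (hat k w (hmem hw))] at h
    rw [dist_eq_norm]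
    refine h.trans_lt ?_
    rw [div_lt_iff₀ hr2]
    nlinarith [mul_pos hε hr]
  have hex : ∀ w, ∃ g : E →L[ℂ] ℂ, w ∈ Metric.ball z (r / 2) →
      Tendsto (fun k => fderiv ℂ (F k) w) atTop (𝓝 g) := by
    intro w
    by_cases hw : w ∈ Metric.ball z (r / 2)
    · obtain ⟨g, hg⟩ := cauchySeq_tendsto_of_complete (hcau.cauchySeq hw)
      exact ⟨g, fun _ => hg⟩
    · exact ⟨0, fun h => absurd h hw⟩
  choose g hg using hex
  have hunif := hcau.tendstoUniformlyOn_of_tendsto hg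
  exact (hasFDerivAt_of_tendstoUniformlyOn Metric.isOpen_ball hunif
    (fun k w hw => (hat k w (hmem hw)).hasFDerivAt)
    (fun w hw => hlim.tendsto_at (hmem hw)) (Metric.mem_ball_self hr2)).differentiableAt

theorem differentiableAt_tsum_of_norm_le_on_ball {F : ℕ → E → ℂ} {u : ℕ → ℝ} {z : E} {r : ℝ}
    (hr : 0 < r) (hF : ∀ k, DifferentiableOn ℂ (F k) (Metric.ball z r)) (hu : Summable u)
    (hFu : ∀ k, ∀ w ∈ Metric.ball z r, ‖F k w‖ ≤ u k) :
    DifferentiableAt ℂ (fun w => ∑' k, F k w) z :=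
  differentiableAt_of_tendstoUniformlyOn_ball hr
    (fun _ => DifferentiableOn.fun_sum fun k _ => hF k) (tendstoUniformlyOn_tsum_nat hu hFu)

/-- The Schwarz lemma used twice: `dslope h 0` is bounded by `1 / R`, so it varies by at most `2 /
R` from its value `deriv h 0` at the centre, and a second application gives the factor `‖t‖ / R`. -/
theorem norm_slope_sub_deriv_le {h : ℂ → ℂ} {R : ℝ} (hR : 0 < R)
    (hh : DifferentiableOn ℂ h (Metric.ball 0 R))
    (hM : MapsTo h (Metric.ball 0 R) (Metric.closedBall (h 0) 1)) {t : ℂ} (ht : t ≠ 0)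
    (htR : t ∈ Metric.ball (0 : ℂ) R) :
    ‖t⁻¹ * (h t - h 0) - deriv h 0‖ ≤ 2 / R / R * ‖t‖ := by
  have hb : ∀ s ∈ Metric.ball (0 : ℂ) R, ‖dslope h 0 s‖ ≤ 1 / R := fun s hs =>
    Complex.norm_dslope_le_div_of_mapsTo_ball hh hM hs
  have hd : DifferentiableOn ℂ (dslope h 0) (Metric.ball 0 R) :=
    (Complex.differentiableOn_dslope (Metric.ball_mem_nhds 0 hR)).2 hh
  have := Complex.dist_le_div_mul_dist_of_mapsTo_ball hd (R₂ := 2 / R) (fun s hs => by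
    rw [Metric.mem_closedBall, dist_eq_norm]
    calc _ ≤ ‖dslope h 0 s‖ + ‖dslope h 0 0‖ := norm_sub_le _ _
      _ ≤ 1 / R + 1 / R := add_le_add (hb s hs) (hb 0 (Metric.mem_ball_self hR))
      _ = 2 / R := by ring) htR
  rwa [dslope_same, dslope_of_ne _ ht, slope_def_module, sub_zero, dist_eq_norm, dist_zero_right,
    smul_eq_mul] at this

/-- The directional derivatives of a holomorphic function are holomorphic. -/
theorem differentiableOn_fderiv_apply {F : E → ℂ} {U : Set E} (hU : IsOpen U)
    (hF : DifferentiableOn ℂ F U) (v : E) : DifferentiableOn ℂ (fun z => fderiv ℂ F z v) U := by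
  intro z hz
  refine DifferentiableAt.differentiableWithinAt ?_
  -- With radius `1 / 2` in the target, `F` differs by less than `1` between any two points of the
  -- ball, as `norm_slope_sub_deriv_le` requires.
  obtain ⟨ρ, hρ, hρU⟩ : ∃ ρ > 0, Metric.ball z ρ ⊆ U ∩ F ⁻¹' Metric.ball (F z) (1 / 2) :=
    Metric.mem_nhds_iff.1 (inter_mem (hU.mem_nhds hz)
      ((hF.differentiableAt (hU.mem_nhds hz)).continuousAt (Metric.ball_mem_nhds _ (by norm_num))))
  obtain ⟨R, hR, hRv⟩ : ∃ R > 0, R * ‖v‖ ≤ ρ / 2 := by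
    refine ⟨ρ / 2 / (‖v‖ + 1), by positivity, ?_⟩
    rw [div_mul_eq_mul_div, div_le_iff₀ (by positivity)]
    nlinarith [norm_nonneg v]
  have hline : ∀ w ∈ Metric.ball z (ρ / 2), ∀ t ∈ Metric.ball (0 : ℂ) R,
      w + t • v ∈ Metric.ball z ρ := by
    intro w hw t ht
    rw [mem_ball_zero_iff] at ht
    rw [Metric.mem_ball, dist_eq_norm] at hw ⊢
    calc ‖w + t • v - z‖ = ‖(w - z) + t • v‖ := by congr 1; abel
      _ ≤ ‖w - z‖ + ‖t‖ * ‖v‖ := (norm_add_le _ _).trans_eq (by rw [norm_smul])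
      _ ≤ ‖w - z‖ + R * ‖v‖ := by gcongr
      _ < ρ := by linarith
  have hat : ∀ w ∈ Metric.ball z ρ, DifferentiableAt ℂ F w := fun w hw =>
    hF.differentiableAt (hU.mem_nhds (hρU hw).1)
  have hlined : ∀ w : E, Differentiable ℂ (fun t : ℂ => w + t • v) := fun w => by fun_prop
  -- The bound is independent of `w`, so the difference quotients converge uniformly and
  -- Weierstrass' theorem applies.
  have hest : ∀ w ∈ Metric.ball z (ρ / 2), ∀ t ∈ Metric.ball (0 : ℂ) R, t ≠ 0 →
      ‖t⁻¹ * (F (w + t • v) - F w) - fderiv ℂ F w v‖ ≤ 2 / R / R * ‖t‖ := by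
    intro w hw t ht ht0
    have hw' : w ∈ Metric.ball z ρ := Metric.ball_subset_ball (by linarith) hw
    have hder : HasDerivAt (fun t : ℂ => F (w + t • v)) (fderiv ℂ F w v) 0 := by
      have h1 : HasDerivAt (fun t : ℂ => w + t • v) v 0 := by
        simpa using ((hasDerivAt_id (0 : ℂ)).smul_const v).const_add w
      have h2 : HasFDerivAt F (fderiv ℂ F w) (w + (0 : ℂ) • v) := by
        simpa using (hat w hw').hasFDerivAt
      exact h2.comp_hasDerivAt 0 h1
    have := norm_slope_sub_deriv_le (h := fun t : ℂ => F (w + t • v)) hR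
      (fun s hs => ((hat _ (hline w hw s hs)).comp s
        (hlined w s)).differentiableWithinAt)
      (fun s hs => ?_) ht0 ht
    · rw [hder.deriv] at this
      simpa using this
    · have h1 := (hρU (hline w hw s hs)).2
      have h2 := (hρU hw').2
      simp only [mem_preimage, Metric.mem_ball] at h1 h2
      simp only [Metric.mem_closedBall, zero_smul, add_zero]
      linarith [dist_triangle_right (F (w + s • v)) (F w) (F z)]
  set τ : ℕ → ℝ := fun k => R / 2 * (1 / ((k : ℝ) + 1)) with hτ
  have hτpos : ∀ k, 0 < τ k := fun k => by positivity
  have hτlt : ∀ k, τ k < R := fun k => by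
    have : 1 / ((k : ℝ) + 1) ≤ 1 := by
      rw [div_le_one (by positivity)]; linarith [(Nat.cast_nonneg k : (0 : ℝ) ≤ k)]
    calc τ k ≤ R / 2 * 1 := by simp only [hτ]; gcongr
      _ < R := by linarith
  have hτlim : Tendsto τ atTop (𝓝 0) := by
    rw [hτ]
    simpa using tendsto_one_div_add_atTop_nhds_zero_nat.const_mul (R / 2)
  have hτmem : ∀ k, ((τ k : ℝ) : ℂ) ∈ Metric.ball (0 : ℂ) R := fun k => by
    rw [mem_ball_zero_iff, Complex.norm_real, Real.norm_of_nonneg (hτpos k).le]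
    exact hτlt k
  refine differentiableAt_of_tendstoUniformlyOn_ball (half_pos hρ)
    (F := fun k w => ((τ k : ℝ) : ℂ)⁻¹ * (F (w + ((τ k : ℝ) : ℂ) • v) - F w)) (fun k => ?_) ?_
  · intro w hw
    have hw' : w ∈ Metric.ball z ρ := Metric.ball_subset_ball (by linarith) hw
    have h1 : DifferentiableAt ℂ (fun w => F (w + ((τ k : ℝ) : ℂ) • v)) w :=
      (hat _ (hline w hw _ (hτmem k))).comp w (by fun_prop)
    exact ((h1.sub (hat w hw')).const_mul _).differentiableWithinAt
  · rw [Metric.tendstoUniformlyOn_iff]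
    intro ε hε
    have hlim : Tendsto (fun k => 2 / R / R * τ k) atTop (𝓝 0) := by
      simpa using hτlim.const_mul (2 / R / R)
    filter_upwards [hlim.eventually_lt_const hε] with k hk w hw
    rw [dist_comm, dist_eq_norm]
    have := hest w hw _ (hτmem k) (by exact_mod_cast (hτpos k).ne')
    rw [Complex.norm_real, Real.norm_of_nonneg (hτpos k).le] at this
    exact this.trans_lt hk

/-- Differentiation in the first variable is the directional derivative along `(1, 0)`, which
preserves joint holomorphy. -/
theorem differentiableOn_iteratedDeriv_fst {H : ℂ × E → ℂ} {W : Set (ℂ × E)} (hW : IsOpen W)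
    (hH : DifferentiableOn ℂ H W) (k : ℕ) :
    DifferentiableOn ℂ (fun p : ℂ × E => iteratedDeriv k (fun s => H (s, p.2)) p.1) W := by
  induction k with
  | zero => simpa using hH
  | succ k ih =>
    refine (differentiableOn_fderiv_apply hW ih ((1 : ℂ), (0 : E))).congr fun p hp => ?_
    have h1 := (ih.differentiableAt (hW.mem_nhds hp)).hasFDerivAt
    have h2 : HasDerivAt (fun s : ℂ => (s, p.2)) ((1 : ℂ), (0 : E)) p.1 :=
      (hasDerivAt_id p.1).prodMk (hasDerivAt_const p.1 p.2)
    have h3 := h1.comp_hasDerivAt p.1 (f := fun s : ℂ => (s, p.2)) h2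
    rw [iteratedDeriv_succ]
    exact h3.deriv

/-- The Taylor coefficients along the lines through a point depend holomorphically on the
direction. -/
theorem differentiable_iteratedDeriv_line {F : E → ℂ} {U : Set E} (hU : IsOpen U)
    (hF : DifferentiableOn ℂ F U) {z : E} (hz : z ∈ U) (k : ℕ) :
    Differentiable ℂ (fun w : E => iteratedDeriv k (fun s : ℂ => F (z + s • w)) 0) := by
  have hc : Differentiable ℂ (fun p : ℂ × E => z + p.1 • p.2) := by fun_prop
  have hd : DifferentiableOn ℂ (fun p : ℂ × E => F (z + p.1 • p.2))
      ((fun p : ℂ × E => z + p.1 • p.2) ⁻¹' U) :=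
    hF.comp hc.differentiableOn fun _ h => h
  have h := differentiableOn_iteratedDeriv_fst (hU.preimage hc.continuous) hd k
  have h' : DifferentiableOn ℂ (fun w : E => ((0 : ℂ), w)) univ :=
    (by fun_prop : Differentiable ℂ (fun w : E => ((0 : ℂ), w))).differentiableOn
  exact differentiableOn_univ.1 (h.comp h' fun w _ => by simpa using hz)

end SeveralVariables

/-! ### Flat charts from a closed coframe. -/

section FlatCharts

variable {n : ℕ} {X : Type*} [TopologicalSpace X] [ChartedSpace (Fin n → ℂ) X]

/-- The linear form whose alternating version is `formInChart η p z`. -/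
noncomputable def covectorInChart (η : (x : X) → Cotangent (n := n) x) (p : X)
    (z : Fin n → ℂ) : (Fin n → ℂ) →L[ℂ] ℂ :=
  (η ((chartAt (Fin n → ℂ) p).symm z)).comp
      (mfderiv 𝓘(ℂ, Fin n → ℂ) 𝓘(ℂ, Fin n → ℂ) (chartAt (Fin n → ℂ) p).symm z)

/-- For a 1-form, `dη(u, v)` is the antisymmetrised derivative of its coefficients; its vanishing is
the symmetry needed for the Poincaré lemma. -/
theorem fderiv_covectorInChart_symm {η : (x : X) → Cotangent (n := n) x} (hη : IsClosedForm η)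
    {p : X} {z : Fin n → ℂ} (hz : z ∈ (chartAt (Fin n → ℂ) p).target)
    (hd : DifferentiableAt ℂ (covectorInChart η p) z) (u v : Fin n → ℂ) :
    fderiv ℂ (covectorInChart η p) z u v = fderiv ℂ (covectorInChart η p) z v u := by
  have hd' : DifferentiableAt ℂ (formInChart η p) z := by
    have : formInChart η p = fun z =>
      (ContinuousAlternatingMap.ofSubsingletonLIE
        (0 : Fin 1)).toContinuousLinearEquiv.toContinuousLinearMap (covectorInChart η p z) := rfl
    rw [this]
    exact (ContinuousLinearMap.differentiableAt _).comp z hd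
  have h := congrArg (fun a => a ![u, v]) (hη p z hz)
  simp only [extDeriv_apply hd'] at h
  have e : ∀ w : Fin 1 → Fin n → ℂ, (fun x => formInChart η p x w) =
      fun x => covectorInChart η p x (w 0) := fun w => rfl
  have f : ∀ w, fderiv ℂ (fun x => covectorInChart η p x w) z =
      (fderiv ℂ (covectorInChart η p) z).flip w := fun w => by
    rw [fderiv_clm_apply hd (differentiableAt_const w)]
    simp
  simp only [e, f] at h
  simp [Fin.sum_univ_two, Fin.removeNth] at h
  rw [← sub_eq_zero, sub_eq_add_neg]
  exact h

/-- The inverse of the tangent trivialization at `p` is the derivative of the inverse chart, so near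
`p` this is the coordinate expression of the section `η`. -/
theorem contDiffAt_covectorInChart [IsManifold 𝓘(ℂ, Fin n → ℂ) ω X]
    {η : (x : X) → Cotangent (n := n) x} {p : X}
    (hη : ContMDiffAt 𝓘(ℂ, Fin n → ℂ)
      (𝓘(ℂ, Fin n → ℂ).prod 𝓘(ℂ, (Fin n → ℂ) →L[ℂ] ℂ)) ω
      (fun x => (⟨x, η x⟩ : Bundle.TotalSpace ((Fin n → ℂ) →L[ℂ] ℂ) (Cotangent (X := X)))) p) :
    ContDiffAt ℂ ω (covectorInChart η p) (chartAt (Fin n → ℂ) p p) := by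
  rw [contMDiffAt_hom_bundle] at hη
  have h2 := (contMDiffAt_iff.1 hη.2).2
  simp only [modelWithCornersSelf_coe, range_id, contDiffWithinAt_univ] at h2
  refine h2.congr_of_eventuallyEq ?_
  have ht : (chartAt (Fin n → ℂ) p).target ∈ 𝓝 (chartAt (Fin n → ℂ) p p) :=
    (chartAt (Fin n → ℂ) p).open_target.mem_nhds (mem_chart_target _ p)
  filter_upwards [ht] with z hz
  have hs := (chartAt (Fin n → ℂ) p).map_target hz
  have := TangentBundle.symmL_trivializationAt (I := 𝓘(ℂ, Fin n → ℂ)) hs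
  simp [extChartAt, ContinuousLinearMap.inCoordinates] at this ⊢
  -- The type of `mfderiv` depends on the point, so the equality of points is used by substitution.
  have key : ∀ y, y = z →
      (mfderiv 𝓘(ℂ, Fin n → ℂ) 𝓘(ℂ, Fin n → ℂ) (chartAt (Fin n → ℂ) p).symm y :
        (Fin n → ℂ) →L[ℂ] (Fin n → ℂ)) =
      mfderiv 𝓘(ℂ, Fin n → ℂ) 𝓘(ℂ, Fin n → ℂ) (chartAt (Fin n → ℂ) p).symm z := by
    rintro _ rfl; rfl
  exact (congrArg (fun T : (Fin n → ℂ) →L[ℂ] (Fin n → ℂ) => ContinuousLinearMap.comp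
    (η ((chartAt (Fin n → ℂ) p).symm z) : (Fin n → ℂ) →L[ℂ] ℂ) T) (this.trans
      (key _ ((chartAt (Fin n → ℂ) p).right_inv hz)))).symm

/-- The map to `ℂⁿ` whose components are the values of `n` one-forms. -/
noncomputable def coframeMap (η : Fin n → (x : X) → Cotangent (n := n) x) (x : X) :
    TangentSpace 𝓘(ℂ, Fin n → ℂ) x →L[ℂ] (Fin n → ℂ) :=
  ContinuousLinearMap.pi fun j => (η j x : TangentSpace 𝓘(ℂ, Fin n → ℂ) x →L[ℂ] ℂ)

/-- A vector killed by all `η j x` is killed by their span, hence by the coordinate projections. -/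
theorem coframeMap_injective {η : Fin n → (x : X) → Cotangent (n := n) x} {x : X}
    (h : ⊤ ≤ Submodule.span ℂ (Set.range (η · x))) : Function.Injective (coframeMap η x) := by
  rw [injective_iff_map_eq_zero]
  intro v hv
  have h1 : ∀ j, η j x v = 0 := fun j => congrFun hv j
  have h2 : ∀ φ : Cotangent (n := n) x, φ v = 0 := by
    intro φ
    have hφ : φ ∈ Submodule.span ℂ (Set.range (η · x)) := h trivial
    induction hφ using Submodule.span_induction with
    | mem φ hφ => obtain ⟨j, rfl⟩ := hφ; exact h1 j
    | zero => rfl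
    | add a b _ _ ha hb =>
      have : (a + b) v = a v + b v := rfl
      rw [this, ha, hb, add_zero]
    | smul c a _ ha =>
      have : (c • a) v = c • a v := rfl
      rw [this, ha, smul_zero]
  funext j
  exact h2 (ContinuousLinearMap.proj (R := ℂ) (φ := fun _ : Fin n => ℂ) j)

/-- An injective endomorphism of `ℂⁿ` as a continuous linear equivalence. -/
noncomputable def endoEquivOfInjective (T : (Fin n → ℂ) →L[ℂ] (Fin n → ℂ))
    (hT : Function.Injective T) : (Fin n → ℂ) ≃L[ℂ] (Fin n → ℂ) :=
  (LinearEquiv.ofInjectiveEndo T.toLinearMap hT).toContinuousLinearEquiv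

/-- The frame of the tangent bundle given by a coframe. -/
noncomputable def coframeEquiv {η : Fin n → (x : X) → Cotangent (n := n) x}
    (h : ∀ x, ⊤ ≤ Submodule.span ℂ (Set.range (η · x))) (x : X) :
    TangentSpace 𝓘(ℂ, Fin n → ℂ) x ≃L[ℂ] (Fin n → ℂ) :=
  endoEquivOfInjective (coframeMap η x) (coframeMap_injective (h x))

/-- `Φ` is a holomorphic chart in which the frame given by `A` is the constant frame. -/
structure IsFlatChart (A : ∀ x : X, TangentSpace 𝓘(ℂ, Fin n → ℂ) x ≃L[ℂ] (Fin n → ℂ))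
    (Φ : OpenPartialHomeomorph X (Fin n → ℂ)) : Prop where
  mdifferentiable : Φ.MDifferentiable 𝓘(ℂ, Fin n → ℂ) 𝓘(ℂ, Fin n → ℂ)
  mfderiv_apply : ∀ x ∈ Φ.source, ∀ v, mfderiv 𝓘(ℂ, Fin n → ℂ) 𝓘(ℂ, Fin n → ℂ) Φ x v = A x v

/-- Every point has a flat chart. -/
def HasFlatCharts (A : ∀ x : X, TangentSpace 𝓘(ℂ, Fin n → ℂ) x ≃L[ℂ] (Fin n → ℂ)) : Prop :=
  ∀ p : X, ∃ Φ : OpenPartialHomeomorph X (Fin n → ℂ), p ∈ Φ.source ∧ IsFlatChart A Φ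

/-- A closed form is locally exact. -/
theorem exists_primitive_covectorInChart {η : (x : X) → Cotangent (n := n) x}
    (hη : IsClosedForm η) {p : X} {r : ℝ} {c : Fin n → ℂ}
    (hr : Metric.ball c r ⊆ (chartAt (Fin n → ℂ) p).target)
    (hd : DifferentiableOn ℂ (covectorInChart η p) (Metric.ball c r)) :
    ∃ f : (Fin n → ℂ) → ℂ, ∀ z ∈ Metric.ball c r, HasFDerivAt f (covectorInChart η p z) z := by
  have hat : ∀ z ∈ Metric.ball c r, DifferentiableAt ℂ (covectorInChart η p) z := fun z hz =>
    hd.differentiableAt (Metric.isOpen_ball.mem_nhds hz)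
  refine (convex_ball c r).exists_forall_hasFDerivAt_of_fderiv_symmetric Metric.isOpen_ball
    (hd.restrictScalars ℝ) fun z hz u v => ?_
  rw [(hat z hz).fderiv_restrictScalars ℝ]
  exact fderiv_covectorInChart_symm hη (hr hz) (hat z hz) u v

/-- Local primitives of the forms are the flat coordinates: their joint derivative is the coframe,
which is invertible. -/
theorem hasFlatCharts_coframeEquiv [IsManifold 𝓘(ℂ, Fin n → ℂ) ω X]
    {η : Fin n → (x : X) → Cotangent (n := n) x}
    (hη : ∀ p j, ContMDiffAt 𝓘(ℂ, Fin n → ℂ)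
      (𝓘(ℂ, Fin n → ℂ).prod 𝓘(ℂ, (Fin n → ℂ) →L[ℂ] ℂ)) ω
      (fun x => (⟨x, η j x⟩ : Bundle.TotalSpace ((Fin n → ℂ) →L[ℂ] ℂ) (Cotangent (X := X)))) p)
    (hc : ∀ j, IsClosedForm (η j)) (h : ∀ x, ⊤ ≤ Submodule.span ℂ (Set.range (η · x))) :
    HasFlatCharts (coframeEquiv h) := by
  intro p
  set φ := chartAt (Fin n → ℂ) p
  have hφd : φ.MDifferentiable 𝓘(ℂ, Fin n → ℂ) 𝓘(ℂ, Fin n → ℂ) :=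
    mdifferentiable_of_mem_atlas (chart_mem_atlas _ p)
  have hsm : ∀ᶠ z in 𝓝 (φ p), ∀ j, ContDiffAt ℂ ω (covectorInChart (η j) p) z :=
    eventually_all.2 fun j => (contDiffAt_covectorInChart (hη p j)).eventually (by simp)
  obtain ⟨r, hr, hball⟩ := Metric.mem_nhds_iff.1 (inter_mem hsm
    (φ.open_target.mem_nhds (mem_chart_target _ p)))
  have hex : ∀ j, ∃ f : (Fin n → ℂ) → ℂ, ∀ z ∈ Metric.ball (φ p) r,
      HasFDerivAt f (covectorInChart (η j) p z) z := fun j =>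
    exists_primitive_covectorInChart (hc j) (fun z hz => (hball hz).2) fun z hz =>
      (((hball hz).1 j).differentiableAt (by simp)).differentiableWithinAt
  choose f hf using hex
  set ψ : (Fin n → ℂ) → (Fin n → ℂ) := fun z j => f j z
  have hψd : ∀ z ∈ Metric.ball (φ p) r,
      HasFDerivAt ψ (ContinuousLinearMap.pi fun j => covectorInChart (η j) p z) z := fun z hz =>
    hasFDerivAt_pi.2 fun j => hf j z hz
  have hψe : ∀ z (hz : z ∈ Metric.ball (φ p) r), ∃ e : (Fin n → ℂ) ≃L[ℂ] (Fin n → ℂ),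
      HasFDerivAt ψ (e : (Fin n → ℂ) →L[ℂ] (Fin n → ℂ)) z := by
    intro z hz
    refine ⟨(hφd.symm.mfderiv (x := z) (hball hz).2).trans (coframeEquiv h (φ.symm z)), ?_⟩
    refine (hψd z hz).congr_fderiv ?_
    ext v j
    rfl
  have hψc : ContDiffAt ℂ 1 ψ (φ p) := by
    refine contDiffAt_pi.2 fun j => contDiffAt_one_iff.2 ⟨covectorInChart (η j) p,
      Metric.ball (φ p) r, Metric.ball_mem_nhds _ hr, fun z hz => ?_, hf j⟩
    exact ((hball hz).1 j).continuousAt.continuousWithinAt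
  obtain ⟨e, he⟩ := hψe (φ p) (Metric.mem_ball_self hr)
  -- The derivative of `ψ` is known only on the ball, hence the restriction.
  set Ψ := (hψc.toOpenPartialHomeomorph ψ he one_ne_zero).restr (Metric.ball (φ p) r) with hΨ
  have hΨs : Ψ.source ⊆ Metric.ball (φ p) r := by
    rw [hΨ, OpenPartialHomeomorph.restr_source' _ _ Metric.isOpen_ball]
    exact inter_subset_right
  have hΨp : φ p ∈ Ψ.source := by
    rw [hΨ, OpenPartialHomeomorph.restr_source' _ _ Metric.isOpen_ball]
    exact ⟨hψc.mem_toOpenPartialHomeomorph_source he one_ne_zero, Metric.mem_ball_self hr⟩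
  have hΨd : Ψ.MDifferentiable 𝓘(ℂ, Fin n → ℂ) 𝓘(ℂ, Fin n → ℂ) := by
    constructor
    · intro z hz
      exact (hψd z (hΨs hz)).differentiableAt.mdifferentiableAt.mdifferentiableWithinAt
    · intro w hw
      obtain ⟨e, he⟩ := hψe _ (hΨs (Ψ.map_target hw))
      exact (Ψ.hasFDerivAt_symm hw he).differentiableAt.mdifferentiableAt.mdifferentiableWithinAt
  refine ⟨φ.trans Ψ, ⟨mem_chart_source _ p, hΨp⟩, hφd.trans hΨd, fun x hx v => ?_⟩
  have hx1 : x ∈ φ.source := hx.1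
  have hx2 : φ x ∈ Ψ.source := hx.2
  have hcomp := mfderiv_comp x (hΨd.mdifferentiableAt hx2) (hφd.mdifferentiableAt hx1)
  have hsymm := DFunLike.congr_fun (hφd.symm_comp_deriv hx1) v
  have hψx : mfderiv 𝓘(ℂ, Fin n → ℂ) 𝓘(ℂ, Fin n → ℂ) Ψ (φ x) =
      ContinuousLinearMap.pi fun j => covectorInChart (η j) p (φ x) := by
    rw [mfderiv_eq_fderiv]
    exact (hψd _ (hΨs hx2)).fderiv
  have hv : mfderiv 𝓘(ℂ, Fin n → ℂ) 𝓘(ℂ, Fin n → ℂ) (φ.trans Ψ) x v =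
      (ContinuousLinearMap.pi fun j => covectorInChart (η j) p (φ x))
        (mfderiv 𝓘(ℂ, Fin n → ℂ) 𝓘(ℂ, Fin n → ℂ) φ x v) := by
    rw [← hψx]
    exact DFunLike.congr_fun hcomp v
  have key : ∀ (j : Fin n) (y : X) (u : Fin n → ℂ), y = x → u = v →
      (η j y : (Fin n → ℂ) →L[ℂ] ℂ) u = (η j x : (Fin n → ℂ) →L[ℂ] ℂ) v := by
    rintro j y u rfl rfl; rfl
  rw [hv]
  funext j
  exact key j _ _ (φ.left_inv hx1) hsymm

theorem CondA.exists_hasFlatCharts [IsManifold 𝓘(ℂ, Fin n → ℂ) ω X] (hA : CondA n X) :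
    ∃ A : ∀ x : X, TangentSpace 𝓘(ℂ, Fin n → ℂ) x ≃L[ℂ] (Fin n → ℂ), HasFlatCharts A := by
  obtain ⟨η, hη, hc⟩ := hA
  exact ⟨_, hasFlatCharts_coframeEquiv (fun p j => hη.contMDiffAt isOpen_univ (mem_univ p) j) hc
    fun x => hη.generating (mem_univ x)⟩

end FlatCharts

/-! ### Balls and holomorphy in charts. -/

section OpenSets

variable {n : ℕ} {X : Type*} [TopologicalSpace X] {Φ : OpenPartialHomeomorph X (Fin n → ℂ)}
  {Ω : Set X}

theorem isOpen_target_inter_preimage_symm (Φ : OpenPartialHomeomorph X (Fin n → ℂ))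
    (hΩ : IsOpen Ω) : IsOpen (Φ.target ∩ Φ.symm ⁻¹' Ω) :=
  Φ.symm.isOpen_inter_preimage hΩ

/-- A ball in a chart around a point of an open set. -/
theorem exists_ball_subset_chart (hΩ : IsOpen Ω) {x : X} (hx : x ∈ Φ.source) (hxΩ : x ∈ Ω) :
    ∃ r > 0, Metric.ball (Φ x) r ⊆ Φ.target ∩ Φ.symm ⁻¹' Ω :=
  Metric.isOpen_iff.1 (isOpen_target_inter_preimage_symm Φ hΩ) _
    ⟨Φ.map_source hx, by simpa [Φ.left_inv hx] using hxΩ⟩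

end OpenSets

section Transfer

variable {n : ℕ} {X : Type*} [TopologicalSpace X] [ChartedSpace (Fin n → ℂ) X]
  {Φ : OpenPartialHomeomorph X (Fin n → ℂ)} {f : X → ℂ} {Ω : Set X}

theorem mdifferentiableAt_iff_differentiableAt_comp_symm
    (hΦ : Φ.MDifferentiable 𝓘(ℂ, Fin n → ℂ) 𝓘(ℂ, Fin n → ℂ)) {x : X} (hx : x ∈ Φ.source) :
    MDifferentiableAt 𝓘(ℂ, Fin n → ℂ) 𝓘(ℂ, ℂ) f x ↔
      DifferentiableAt ℂ (fun z => f (Φ.symm z)) (Φ x) := by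
  constructor
  · intro h
    rw [← mdifferentiableAt_iff_differentiableAt]
    have h' : MDifferentiableAt 𝓘(ℂ, Fin n → ℂ) 𝓘(ℂ, ℂ) f (Φ.symm (Φ x)) := by
      rwa [Φ.left_inv hx]
    exact h'.comp (Φ x) (hΦ.mdifferentiableAt_symm (Φ.map_source hx))
  · intro h
    have h' := h.mdifferentiableAt.comp x (hΦ.mdifferentiableAt hx)
    refine h'.congr_of_eventuallyEq ?_
    filter_upwards [Φ.open_source.mem_nhds hx] with y hy
    simp [Φ.left_inv hy]

theorem HolomorphicOn.mdifferentiableAt (hf : HolomorphicOn n f Ω) (hΩ : IsOpen Ω) {x : X}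
    (hx : x ∈ Ω) : MDifferentiableAt 𝓘(ℂ, Fin n → ℂ) 𝓘(ℂ, ℂ) f x :=
  MDifferentiableOn.mdifferentiableAt hf (hΩ.mem_nhds hx)

theorem HolomorphicOn.continuousOn (hf : HolomorphicOn n f Ω) : ContinuousOn f Ω :=
  MDifferentiableOn.continuousOn hf

theorem HolomorphicOn.differentiableAt_comp_symm (hf : HolomorphicOn n f Ω) (hΩ : IsOpen Ω)
    (hΦ : Φ.MDifferentiable 𝓘(ℂ, Fin n → ℂ) 𝓘(ℂ, Fin n → ℂ)) {z : Fin n → ℂ}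
    (hz : z ∈ Φ.target ∩ Φ.symm ⁻¹' Ω) : DifferentiableAt ℂ (fun z => f (Φ.symm z)) z := by
  have := (mdifferentiableAt_iff_differentiableAt_comp_symm hΦ (Φ.map_target hz.1)).1
    (hf.mdifferentiableAt hΩ hz.2)
  rwa [Φ.right_inv hz.1] at this

theorem HolomorphicOn.differentiableOn_comp_symm (hf : HolomorphicOn n f Ω) (hΩ : IsOpen Ω)
    (hΦ : Φ.MDifferentiable 𝓘(ℂ, Fin n → ℂ) 𝓘(ℂ, Fin n → ℂ)) :
    DifferentiableOn ℂ (fun z => f (Φ.symm z)) (Φ.target ∩ Φ.symm ⁻¹' Ω) :=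
  fun _ hz => (hf.differentiableAt_comp_symm hΩ hΦ hz).differentiableWithinAt

end Transfer

/-! ### Derivatives along the frame and Cauchy estimates. -/

section FlatDerivative

variable {n : ℕ} {X : Type*} [TopologicalSpace X] [ChartedSpace (Fin n → ℂ) X]

/-- The derivative of `f` along the vector field with constant coordinates `v` in the frame
given by `A`. -/
noncomputable def flatDeriv (A : ∀ x : X, TangentSpace 𝓘(ℂ, Fin n → ℂ) x ≃L[ℂ] (Fin n → ℂ))
    (v : Fin n → ℂ) (f : X → ℂ) (x : X) : ℂ :=
  mfderiv 𝓘(ℂ, Fin n → ℂ) 𝓘(ℂ, ℂ) f x ((A x).symm v)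

variable {A : ∀ x : X, TangentSpace 𝓘(ℂ, Fin n → ℂ) x ≃L[ℂ] (Fin n → ℂ)}
  {Φ : OpenPartialHomeomorph X (Fin n → ℂ)} {f : X → ℂ} {Ω : Set X}

/-- Since `dΦ = A` in a flat chart, the field `A⁻¹ v` is the image of the constant field `v` under
`dΦ⁻¹`; the chain rule does the rest. -/
theorem flatDeriv_symm_apply (hΦ : IsFlatChart A Φ) (hΩ : IsOpen Ω) (hf : HolomorphicOn n f Ω)
    (v : Fin n → ℂ) {z : Fin n → ℂ} (hz : z ∈ Φ.target ∩ Φ.symm ⁻¹' Ω) :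
    flatDeriv A v f (Φ.symm z) = fderiv ℂ (fun z => f (Φ.symm z)) z v := by
  have h1 := mfderiv_comp z (hf.mdifferentiableAt hΩ hz.2)
    (hΦ.mdifferentiable.mdifferentiableAt_symm hz.1)
  have h2 := DFunLike.congr_fun (hΦ.mdifferentiable.comp_symm_deriv hz.1) v
  have h3 : (A (Φ.symm z)).symm v =
      mfderiv 𝓘(ℂ, Fin n → ℂ) 𝓘(ℂ, Fin n → ℂ) Φ.symm z v := by
    rw [ContinuousLinearEquiv.symm_apply_eq, ← hΦ.mfderiv_apply _ (Φ.map_target hz.1)]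
    exact h2.symm
  rw [flatDeriv, h3, ← mfderiv_eq_fderiv]
  exact (DFunLike.congr_fun h1 v).symm

theorem HolomorphicOn.flatDeriv (hA : HasFlatCharts A) (hΩ : IsOpen Ω)
    (hf : HolomorphicOn n f Ω) (v : Fin n → ℂ) : HolomorphicOn n (flatDeriv A v f) Ω := by
  intro x hx
  obtain ⟨Φ, hxΦ, hΦ⟩ := hA x
  refine MDifferentiableAt.mdifferentiableWithinAt ?_
  rw [mdifferentiableAt_iff_differentiableAt_comp_symm hΦ.mdifferentiable hxΦ]
  have hO := isOpen_target_inter_preimage_symm Φ hΩ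
  have hmem : Φ x ∈ Φ.target ∩ Φ.symm ⁻¹' Ω :=
    ⟨Φ.map_source hxΦ, by simpa [Φ.left_inv hxΦ] using hx⟩
  refine ((differentiableOn_fderiv_apply hO
    (hf.differentiableOn_comp_symm hΩ hΦ.mdifferentiable) v).congr fun z hz =>
      flatDeriv_symm_apply hΦ hΩ hf v hz).differentiableAt (hO.mem_nhds hmem)

theorem HolomorphicOn.iterate_flatDeriv (hA : HasFlatCharts A)
    (hΩ : IsOpen Ω) (hf : HolomorphicOn n f Ω) (v : Fin n → ℂ) (k : ℕ) :
    HolomorphicOn n ((CartanThullen.flatDeriv A v)^[k] f) Ω := by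
  induction k with
  | zero => exact hf
  | succ k ih =>
    rw [Function.iterate_succ_apply']
    exact ih.flatDeriv hA hΩ v

theorem iterate_flatDeriv_symm_apply (hA : HasFlatCharts A)
    (hΦ : IsFlatChart A Φ) (hΩ : IsOpen Ω) (hf : HolomorphicOn n f Ω) (v : Fin n → ℂ) (k : ℕ)
    {z : Fin n → ℂ} (hz : z ∈ Φ.target ∩ Φ.symm ⁻¹' Ω) :
    (flatDeriv A v)^[k] f (Φ.symm z) = iteratedDeriv k (fun t : ℂ => f (Φ.symm (z + t • v))) 0 := by
  induction k generalizing z with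
  | zero => simp
  | succ k ih =>
    have hg := hf.iterate_flatDeriv hA hΩ v k
    rw [Function.iterate_succ_apply', flatDeriv_symm_apply hΦ hΩ hg v hz, iteratedDeriv_succ]
    have h1 : HasDerivAt (fun t : ℂ => z + t • v) v 0 := by
      simpa using ((hasDerivAt_id (0 : ℂ)).smul_const v).const_add z
    have h2 : HasFDerivAt (fun z => (flatDeriv A v)^[k] f (Φ.symm z))
        (fderiv ℂ (fun z => (flatDeriv A v)^[k] f (Φ.symm z)) z) (z + (0 : ℂ) • v) := by
      simpa using (hg.differentiableAt_comp_symm hΩ hΦ.mdifferentiable hz).hasFDerivAt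
    rw [← (h2.comp_hasDerivAt (0 : ℂ) h1).deriv]
    -- By translation, the `k`-th derivative at parameter `t` is the one at `0` along the line based
    -- at `z + t • v`.
    refine EventuallyEq.deriv_eq ?_
    have hO := isOpen_target_inter_preimage_symm Φ hΩ
    have hmem : z + (0 : ℂ) • v ∈ Φ.target ∩ Φ.symm ⁻¹' Ω := by simpa using hz
    filter_upwards [h1.continuousAt.preimage_mem_nhds (hO.mem_nhds hmem)] with t ht
    have := congrFun (iteratedDeriv_comp_add_const k
      (fun s : ℂ => f (Φ.symm (z + s • v))) t) 0
    rw [zero_add] at this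
    rw [Function.comp_apply, ih ht, ← this]
    simp only [add_smul, add_assoc, add_comm]

/-- Cauchy's estimates for the iterated derivatives along the frame. -/
theorem norm_iterate_flatDeriv_symm_le (hA : HasFlatCharts A)
    (hΦ : IsFlatChart A Φ) (hΩ : IsOpen Ω) (hf : HolomorphicOn n f Ω) {z : Fin n → ℂ} {r M : ℝ}
    (hr : 0 ≤ r) (hz : Metric.closedBall z r ⊆ Φ.target ∩ Φ.symm ⁻¹' Ω)
    (hM : ∀ w ∈ Metric.closedBall z r, ‖f (Φ.symm w)‖ ≤ M)
    (v : Fin n → ℂ) {R : ℝ} (hR : 0 < R) (hRv : R * ‖v‖ ≤ r) (k : ℕ) :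
    ‖(flatDeriv A v)^[k] f (Φ.symm z)‖ ≤ k.factorial * M / R ^ k := by
  rw [iterate_flatDeriv_symm_apply hA hΦ hΩ hf v k (hz (Metric.mem_closedBall_self hr))]
  have hmem : ∀ t ∈ Metric.closedBall (0 : ℂ) R, z + t • v ∈ Metric.closedBall z r := by
    intro t ht
    rw [mem_closedBall_zero_iff] at ht
    rw [Metric.mem_closedBall, dist_eq_norm, add_sub_cancel_left, norm_smul]
    exact (mul_le_mul_of_nonneg_right ht (norm_nonneg v)).trans hRv
  refine Complex.norm_iteratedDeriv_le_of_forall_mem_sphere_norm_le k hR ?_ fun t ht =>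
    hM _ (hmem t (Metric.sphere_subset_closedBall ht))
  refine DifferentiableOn.diffContOnCl fun t ht => ?_
  rw [closure_ball _ hR.ne'] at ht
  refine DifferentiableAt.differentiableWithinAt ?_
  exact (hf.differentiableAt_comp_symm hΩ hΦ.mdifferentiable (hz (hmem t ht))).comp t
    (f := fun t : ℂ => z + t • v) (by fun_prop)

/-- Cauchy's estimates, uniformly on a compact set. -/
theorem exists_uniform_cauchy_estimate (hA : HasFlatCharts A)
    (hΩ : IsOpen Ω) {K : Set X} (hK : IsCompact K) (hKΩ : K ⊆ Ω) :
    ∃ r > 0, ∃ L : Set X, IsCompact L ∧ L ⊆ Ω ∧ ∀ f : X → ℂ, HolomorphicOn n f Ω → ∀ M : ℝ,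
      (∀ y ∈ L, ‖f y‖ ≤ M) → ∀ x ∈ K, ∀ v : Fin n → ℂ, ∀ R > 0, R * ‖v‖ ≤ r → ∀ k,
        ‖(flatDeriv A v)^[k] f x‖ ≤ k.factorial * M / R ^ k := by
  -- The property passes to subsets and finite unions, so it suffices to find `r` and `L` near each
  -- point.
  refine hK.induction_on (p := fun S => ∃ r > 0, ∃ L : Set X, IsCompact L ∧ L ⊆ Ω ∧
    ∀ f : X → ℂ, HolomorphicOn n f Ω → ∀ M : ℝ,
      (∀ y ∈ L, ‖f y‖ ≤ M) → ∀ x ∈ S, ∀ v : Fin n → ℂ, ∀ R > 0, R * ‖v‖ ≤ r → ∀ k,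
        ‖(flatDeriv A v)^[k] f x‖ ≤ k.factorial * M / R ^ k) ?_ ?_ ?_ ?_
  · exact ⟨1, one_pos, ∅, isCompact_empty, empty_subset _, fun f _ M _ x hx => hx.elim⟩
  · rintro S T hST ⟨r, hr, L, hL, hLΩ, h⟩
    exact ⟨r, hr, L, hL, hLΩ, fun f hf M hM x hx => h f hf M hM x (hST hx)⟩
  · rintro S T ⟨r, hr, L, hL, hLΩ, h⟩ ⟨r', hr', L', hL', hLΩ', h'⟩
    refine ⟨min r r', lt_min hr hr', L ∪ L', hL.union hL', union_subset hLΩ hLΩ', ?_⟩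
    rintro f hf M hM x (hx | hx) v R hR hRv k
    · exact h f hf M (fun y hy => hM y (Or.inl hy)) x hx v R hR (hRv.trans (min_le_left _ _)) k
    · exact h' f hf M (fun y hy => hM y (Or.inr hy)) x hx v R hR (hRv.trans (min_le_right _ _)) k
  · intro p hp
    obtain ⟨Φ, hpΦ, hΦ⟩ := hA p
    obtain ⟨r, hr, hball⟩ := exists_ball_subset_chart (Φ := Φ) hΩ hpΦ (hKΩ hp)
    have hsub : Metric.closedBall (Φ p) (r / 2) ⊆ Φ.target ∩ Φ.symm ⁻¹' Ω :=
      (Metric.closedBall_subset_ball (by linarith)).trans hball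
    refine ⟨Φ.source ∩ Φ ⁻¹' Metric.ball (Φ p) (r / 4), mem_nhdsWithin_of_mem_nhds
      ((Φ.isOpen_inter_preimage Metric.isOpen_ball).mem_nhds
        ⟨hpΦ, Metric.mem_ball_self (by positivity)⟩), r / 4, by positivity,
      Φ.symm '' Metric.closedBall (Φ p) (r / 2), ?_, ?_, ?_⟩
    · exact (isCompact_closedBall _ _).image_of_continuousOn
        (Φ.continuousOn_symm.mono fun z hz => (hsub hz).1)
    · rintro _ ⟨z, hz, rfl⟩
      exact (hsub hz).2
    · rintro f hf M hM x ⟨hx, hxb⟩ v R hR hRv k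
      rw [← Φ.left_inv hx]
      have hb : Metric.closedBall (Φ x) (r / 4) ⊆ Metric.closedBall (Φ p) (r / 2) :=
        Metric.closedBall_subset_closedBall' (by
          have : dist (Φ x) (Φ p) < r / 4 := hxb
          linarith)
      exact norm_iterate_flatDeriv_symm_le hA hΦ hΩ hf (by positivity) (hb.trans hsub)
        (fun w hw => hM _ ⟨w, hb hw, rfl⟩) v hR hRv k

end FlatDerivative

/-! ### Homogeneous Taylor expansions. -/

section Taylor

variable {E : Type*} [NormedAddCommGroup E] [NormedSpace ℂ E]

/-- The sum of the homogeneous Taylor expansion of `F` at `c`. -/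
noncomputable def taylorSum (F : E → ℂ) (c z : E) : ℂ :=
  ∑' k : ℕ, (k.factorial : ℂ)⁻¹ * iteratedDeriv k (fun t : ℂ => F (c + t • (z - c))) 0

variable {F : E → ℂ} {O : Set E} {c : E}

/-- Near `z` all directions `w - c` have norm at most some `s' < s`; the hypothesis with `R = s / s'
> 1` dominates the series by a geometric one. -/
theorem differentiableOn_taylorSum (hO : IsOpen O) (hF : DifferentiableOn ℂ F O) (hc : c ∈ O)
    {s M : ℝ} (hM : ∀ w : E, ∀ R > 0, R * ‖w‖ ≤ s → ∀ k,
      ‖iteratedDeriv k (fun t : ℂ => F (c + t • w)) 0‖ ≤ k.factorial * M / R ^ k) :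
    DifferentiableOn ℂ (taylorSum F c) (Metric.ball c s) := by
  intro z hz
  rw [Metric.mem_ball, dist_eq_norm] at hz
  refine DifferentiableAt.differentiableWithinAt ?_
  set s' := (‖z - c‖ + s) / 2 with hs'
  have hs0 : 0 < s' := by linarith [norm_nonneg (z - c)]
  have hR : 1 < s / s' := (one_lt_div hs0).2 (by linarith)
  refine differentiableAt_tsum_of_norm_le_on_ball (r := s' - ‖z - c‖) (by linarith)
    (u := fun k => M * (s / s')⁻¹ ^ k) (fun k => ?_) ?_ fun k w hw => ?_
  · refine Differentiable.differentiableOn ?_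
    exact ((differentiable_iteratedDeriv_line hO hF hc k).comp
      (differentiable_id.sub_const c)).const_mul _
  · exact (summable_geometric_of_lt_one (by positivity) (inv_lt_one_of_one_lt₀ hR)).mul_left M
  · have hwc : ‖w - c‖ ≤ s' := by
      rw [Metric.mem_ball, dist_eq_norm] at hw
      calc ‖w - c‖ = ‖(w - z) + (z - c)‖ := by congr 1; abel
        _ ≤ ‖w - z‖ + ‖z - c‖ := norm_add_le _ _
        _ ≤ s' := by linarith
    have hle : s / s' * ‖w - c‖ ≤ s := by
      calc s / s' * ‖w - c‖ ≤ s / s' * s' := by gcongr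
        _ = s := div_mul_cancel₀ _ hs0.ne'
    have := hM (w - c) (s / s') (by linarith) hle k
    have hk : (0 : ℝ) < k.factorial := by exact_mod_cast k.factorial_pos
    rw [norm_mul, norm_inv, Complex.norm_natCast]
    calc _ ≤ (k.factorial : ℝ)⁻¹ * (k.factorial * M / (s / s') ^ k) := by gcongr
      _ = M * (s / s')⁻¹ ^ k := by
        rw [inv_pow]; field_simp

/-- On the complex line through `c` and `z` this is the one-variable Taylor series at `t = 1`,
inside a disc of radius `R > 1`. -/
theorem taylorSum_eq {ε : ℝ} (hF : DifferentiableOn ℂ F (Metric.ball c ε)) {z : E}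
    (hz : z ∈ Metric.ball c ε) : taylorSum F c z = F z := by
  rw [Metric.mem_ball, dist_eq_norm] at hz
  have hε : 0 < ε := (norm_nonneg _).trans_lt hz
  obtain ⟨R, hR, hR1⟩ : ∃ R, R * ‖z - c‖ < ε ∧ R ∈ Ioi 1 := by
    have hcont : Tendsto (fun R : ℝ => R * ‖z - c‖) (𝓝[>] 1) (𝓝 (1 * ‖z - c‖)) :=
      ((continuous_id.mul continuous_const).tendsto _).mono_left nhdsWithin_le_nhds
    rw [one_mul] at hcont
    exact ((hcont.eventually_lt_const hz).and self_mem_nhdsWithin).exists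
  have hd : DifferentiableOn ℂ (fun t : ℂ => F (c + t • (z - c))) (Metric.ball 0 R) := by
    intro t ht
    rw [mem_ball_zero_iff] at ht
    refine DifferentiableAt.differentiableWithinAt ?_
    refine (hF.differentiableAt (Metric.isOpen_ball.mem_nhds ?_)).comp t
      (f := fun t : ℂ => c + t • (z - c)) (by fun_prop)
    rw [Metric.mem_ball, dist_eq_norm, add_sub_cancel_left, norm_smul]
    exact (mul_le_mul_of_nonneg_right ht.le (norm_nonneg _)).trans_lt hR
  have := Complex.taylorSeries_eq_on_ball' (c := 0) (z := 1) (by simpa using hR1) hd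
  simpa [taylorSum] using this

end Taylor

/-! ### Domains of holomorphy are holomorphically convex. -/

section DomainOfHolomorphy

variable {n : ℕ} {X : Type*} [TopologicalSpace X] [ChartedSpace (Fin n → ℂ) X]
  {A : ∀ x : X, TangentSpace 𝓘(ℂ, Fin n → ℂ) x ≃L[ℂ] (Fin n → ℂ)}
  {Φ : OpenPartialHomeomorph X (Fin n → ℂ)} {f : X → ℂ} {Ω : Set X}

/-- The condition `0 ≤ C` covers empty `K`, where the supremum is `0`. -/
theorem norm_le_of_mem_holHull {K : Set X} {x : X} (hx : x ∈ holHull n Ω K)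
    (hf : HolomorphicOn n f Ω) {C : ℝ} (hC : 0 ≤ C) (hK : ∀ y ∈ K, ‖f y‖ ≤ C) : ‖f x‖ ≤ C :=
  (hx.2 f hf).trans (Real.sSup_le (by rintro _ ⟨y, hy, rfl⟩; exact hK y hy) hC)

/-- A function whose derivatives along the frame satisfy Cauchy estimates at a point extends to
a ball in a flat chart. -/
theorem exists_holomorphic_extension (hA : HasFlatCharts A)
    (hΦ : IsFlatChart A Φ) (hΩ : IsOpen Ω) (hf : HolomorphicOn n f Ω) {x : X}
    (hx : x ∈ Φ.source) (hxΩ : x ∈ Ω) {s ε M : ℝ} (hs : Metric.ball (Φ x) s ⊆ Φ.target)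
    (hε : Metric.ball (Φ x) ε ⊆ Φ.target ∩ Φ.symm ⁻¹' Ω)
    (hM : ∀ v : Fin n → ℂ, ∀ R > 0, R * ‖v‖ ≤ s → ∀ k,
      ‖(flatDeriv A v)^[k] f x‖ ≤ k.factorial * M / R ^ k) :
    ∃ g : X → ℂ, HolomorphicOn n g (Φ.symm '' Metric.ball (Φ x) s) ∧
      EqOn f g (Φ.symm '' Metric.ball (Φ x) ε) := by
  have hxO : Φ x ∈ Φ.target ∩ Φ.symm ⁻¹' Ω :=
    ⟨Φ.map_source hx, by simpa [Φ.left_inv hx] using hxΩ⟩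
  have hF := hf.differentiableOn_comp_symm hΩ hΦ.mdifferentiable
  have hG := differentiableOn_taylorSum (isOpen_target_inter_preimage_symm Φ hΩ) hF hxO
    (s := s) (M := M) fun v R hR hRv k => by
      rw [← iterate_flatDeriv_symm_apply hA hΦ hΩ hf v k hxO, Φ.left_inv hx]
      exact hM v R hR hRv k
  refine ⟨fun y => taylorSum (fun z => f (Φ.symm z)) (Φ x) (Φ y), ?_, ?_⟩
  · rintro _ ⟨z, hz, rfl⟩
    refine MDifferentiableAt.mdifferentiableWithinAt ?_
    rw [mdifferentiableAt_iff_differentiableAt_comp_symm hΦ.mdifferentiable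
      (Φ.map_target (hs hz)), Φ.right_inv (hs hz)]
    refine (hG.differentiableAt (Metric.isOpen_ball.mem_nhds hz)).congr_of_eventuallyEq ?_
    filter_upwards [Metric.isOpen_ball.mem_nhds hz] with w hw
    rw [Φ.right_inv (hs hw)]
  · rintro _ ⟨z, hz, rfl⟩
    simp only
    rw [Φ.right_inv (hε hz).1, taylorSum_eq (hF.mono hε) hz]

/-- Under a flat frame, a relatively compact domain of holomorphy is holomorphically convex. -/
theorem IsDomainOfHolomorphy.holomorphicallyConvex
    (hA : HasFlatCharts A) (hΩ : IsOpen Ω)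
    (hc : IsCompact (closure Ω)) (h : IsDomainOfHolomorphy n Ω) : HolomorphicallyConvex n Ω := by
  intro K hK hKΩ
  have hsub : holHull n Ω K ⊆ Ω := fun x hx => hx.1
  refine ⟨hc.of_isClosed_subset isClosed_closure (closure_mono hsub), fun b hb => ?_⟩
  by_contra hbΩ
  refine h ⟨b, ⟨closure_mono hsub hb, by rwa [hΩ.interior_eq]⟩, ?_⟩
  obtain ⟨r, hr, L, hL, hLΩ, hest⟩ := exists_uniform_cauchy_estimate hA hΩ hK hKΩ
  obtain ⟨Φ, hbΦ, hΦ⟩ := hA b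
  obtain ⟨ρ, hρ, hball⟩ := exists_ball_subset_chart (Φ := Φ) isOpen_univ hbΦ (mem_univ b)
  -- The bound by `r` keeps the Cauchy estimates; the bound by `ρ / 2` keeps the `s`-ball about `Φ
  -- x` in the chart for every `x` within `s` of `b`.
  set s := min r (ρ / 2) with hs
  have hs0 : 0 < s := lt_min hr (half_pos hρ)
  have hsr : s ≤ r := min_le_left _ _
  have hsρ : s ≤ ρ / 2 := min_le_right _ _
  obtain ⟨x, ⟨hxΦ, hxb⟩, hx⟩ := mem_closure_iff.1 hb _
    (Φ.isOpen_inter_preimage (Metric.isOpen_ball (x := Φ b) (ε := s)))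
    ⟨hbΦ, Metric.mem_ball_self hs0⟩
  have hxb' : dist (Φ x) (Φ b) < s := hxb
  have hst : Metric.ball (Φ x) s ⊆ Φ.target := fun z hz =>
    (hball (Metric.ball_subset_ball' (by linarith) hz)).1
  obtain ⟨ε, hε, hεball⟩ := exists_ball_subset_chart (Φ := Φ) hΩ hxΦ hx.1
  set ε' := min ε s with hε'
  have hε0 : 0 < ε' := lt_min hε hs0
  have hεs : Metric.ball (Φ x) ε' ⊆ Metric.ball (Φ x) s :=
    Metric.ball_subset_ball (min_le_right _ _)
  have hεO : Metric.ball (Φ x) ε' ⊆ Φ.target ∩ Φ.symm ⁻¹' Ω :=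
    (Metric.ball_subset_ball (min_le_left _ _)).trans hεball
  refine ⟨Φ.symm '' Metric.ball (Φ x) s, Φ.symm '' Metric.ball (Φ x) ε',
    Φ.symm.isOpen_image_of_subset_source Metric.isOpen_ball hst, ?_, ?_,
    Φ.symm.isOpen_image_of_subset_source Metric.isOpen_ball (hεs.trans hst),
    (Metric.nonempty_ball.2 hε0).image _, ?_, fun f hf => ?_⟩
  · exact ((convex_ball (Φ x) s).isConnected (Metric.nonempty_ball.2 hs0)).image _
      (Φ.continuousOn_symm.mono hst)
  · exact ⟨Φ b, by rwa [Metric.mem_ball, dist_comm], Φ.left_inv hbΦ⟩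
  · rintro _ ⟨z, hz, rfl⟩
    exact ⟨⟨z, hεs hz, rfl⟩, (hεO hz).2⟩
  · obtain ⟨M, hM⟩ := hL.exists_bound_of_continuousOn (hf.continuousOn.mono hLΩ)
    refine exists_holomorphic_extension hA hΦ hΩ hf hxΦ hx.1 hst hεO (M := max M 0)
      fun v R hR hRv k => ?_
    exact norm_le_of_mem_holHull hx (hf.iterate_flatDeriv hA hΩ v k) (by positivity)
      fun y hy => hest f hf (max M 0) (fun y hy => (hM y hy).trans (le_max_left _ _)) y hy v R hR
        (hRv.trans hsr) k

end DomainOfHolomorphy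

/-! ### The identity theorem. -/

section IdentityTheorem

/-- The identity theorem on balls: a holomorphic function on a ball that vanishes near one point
of the ball vanishes on the ball. -/
theorem eq_zero_of_eventuallyEq_zero_of_mem_ball {E : Type*} [NormedAddCommGroup E]
    [NormedSpace ℂ E] {F : E → ℂ} {a c z : E} {r : ℝ}
    (hF : DifferentiableOn ℂ F (Metric.ball a r)) (hc : c ∈ Metric.ball a r)
    (h0 : ∀ᶠ w in 𝓝 c, F w = 0) (hz : z ∈ Metric.ball a r) : F z = 0 := by
  let _ : NormedSpace ℝ E := NormedSpace.restrictScalars ℝ ℂ E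
  have : IsScalarTower ℝ ℂ E := .restrictScalars ℝ ℂ E
  -- The complex line through `c` and `z` meets the ball in a convex, hence connected, set of
  -- parameters.
  set l : ℂ →ᵃ[ℝ] E := ((LinearMap.toSpanSingleton ℂ E (z - c)).restrictScalars ℝ).toAffineMap +
    AffineMap.const ℝ ℂ c with hl
  have hl' : ∀ t, l t = t • (z - c) + c := fun t => by simp [hl]
  have hld : Differentiable ℂ l := by
    have : (l : ℂ → E) = fun t => t • (z - c) + c := funext hl'
    rw [this]; fun_prop
  have hconv : Convex ℝ (l ⁻¹' Metric.ball a r) :=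
    (convex_ball a r).affine_preimage l
  have hopen : IsOpen (l ⁻¹' Metric.ball a r) := Metric.isOpen_ball.preimage hld.continuous
  have han : AnalyticOnNhd ℂ (fun t => F (l t)) (l ⁻¹' Metric.ball a r) :=
    (hF.comp hld.differentiableOn fun _ h => h).analyticOnNhd hopen
  have hl0 : l 0 = c := by simp [hl']
  have hl1 : l 1 = z := by simp [hl']
  have hev : (fun t => F (l t)) =ᶠ[𝓝 0] 0 := by
    have := hld.continuous.tendsto 0
    rw [hl0] at this
    exact this.eventually h0
  have := han.eqOn_zero_of_preconnected_of_eventuallyEq_zero hconv.isPreconnected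
    (by simpa [hl0] using hc) hev (show (1 : ℂ) ∈ l ⁻¹' Metric.ball a r by simpa [hl1] using hz)
  simpa [hl1] using this

variable {n : ℕ} {X : Type*} [TopologicalSpace X] [ChartedSpace (Fin n → ℂ) X]

/-- The identity theorem on complex manifolds. -/
theorem HolomorphicOn.eqOn_of_isPreconnected [IsManifold 𝓘(ℂ, Fin n → ℂ) 1 X] {f g : X → ℂ}
    {W V : Set X} (hf : HolomorphicOn n f W) (hg : HolomorphicOn n g W) (hW : IsOpen W)
    (hWc : IsPreconnected W) (hV : IsOpen V) (hVW : (W ∩ V).Nonempty) (h : EqOn f g V) :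
    EqOn f g W := by
  have hsub : W ⊆ interior {x | f x = g x} := by
    -- The interior of the coincidence set is open, meets `W` and is relatively closed in it.
    refine hWc.subset_of_closure_inter_subset isOpen_interior
      (hVW.mono (inter_subset_inter_right W (interior_maximal h hV))) ?_
    rintro p ⟨hp, hpW⟩
    set φ := chartAt (Fin n → ℂ) p
    have hφd : φ.MDifferentiable 𝓘(ℂ, Fin n → ℂ) 𝓘(ℂ, Fin n → ℂ) :=
      mdifferentiable_of_mem_atlas (chart_mem_atlas _ p)
    have hpφ : p ∈ φ.source := mem_chart_source _ p
    obtain ⟨r, hr, hball⟩ := exists_ball_subset_chart (Φ := φ) hW hpφ hpW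
    have hN : IsOpen (φ.source ∩ φ ⁻¹' Metric.ball (φ p) r) :=
      φ.isOpen_inter_preimage Metric.isOpen_ball
    have hpN : p ∈ φ.source ∩ φ ⁻¹' Metric.ball (φ p) r := ⟨hpφ, Metric.mem_ball_self hr⟩
    obtain ⟨q, ⟨hqφ, hqb⟩, hq⟩ := mem_closure_iff.1 hp _ hN hpN
    refine mem_interior.2 ⟨_, ?_, hN, hpN⟩
    rintro x ⟨hxφ, hxb⟩
    have hd : DifferentiableOn ℂ (fun z => f (φ.symm z) - g (φ.symm z)) (Metric.ball (φ p) r) :=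
      ((hf.differentiableOn_comp_symm hW hφd).sub
        (hg.differentiableOn_comp_symm hW hφd)).mono hball
    have hev : ∀ᶠ w in 𝓝 (φ q), f (φ.symm w) - g (φ.symm w) = 0 := by
      have hcont := (φ.continuousAt_symm (φ.map_source hqφ)).tendsto
      rw [φ.left_inv hqφ] at hcont
      filter_upwards [hcont.eventually (mem_interior_iff_mem_nhds.1 hq)] with w hw
      exact sub_eq_zero.2 hw
    have := eq_zero_of_eventuallyEq_zero_of_mem_ball hd hqb hev hxb
    rw [φ.left_inv hxφ] at this
    exact sub_eq_zero.1 this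
  exact hsub.trans interior_subset

end IdentityTheorem

/-! ### Compact exhaustions. -/

section Exhaustion

/-- An open subset of a compact subset of a manifold is `σ`-compact. -/
theorem isSigmaCompact_of_isOpen_of_isCompact (H : Type*) {X : Type*} [TopologicalSpace H]
    [LocallyCompactSpace H] [SecondCountableTopology H] [TopologicalSpace X] [ChartedSpace H X]
    {Ω K : Set X} (hΩ : IsOpen Ω) (hK : IsCompact K)
    (hΩK : Ω ⊆ K) : IsSigmaCompact Ω := by
  have hchart : ∀ p : X, IsSigmaCompact (Ω ∩ (chartAt H p).source) := by
    intro p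
    set φ := chartAt H p
    have hO : IsOpen (φ.symm.source ∩ φ.symm ⁻¹' Ω) := φ.symm.isOpen_inter_preimage hΩ
    have := hO.locallyCompactSpace
    have hσ : IsSigmaCompact (φ.symm.source ∩ φ.symm ⁻¹' Ω) :=
      isSigmaCompact_iff_sigmaCompactSpace.2 inferInstance
    have := hσ.image_of_continuousOn (φ.continuousOn_symm.mono fun z hz => hz.1)
    convert this using 1
    ext x
    constructor
    · rintro ⟨hx, hxφ⟩
      exact ⟨φ x, ⟨φ.map_source hxφ, by simpa [φ.left_inv hxφ] using hx⟩, φ.left_inv hxφ⟩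
    · rintro ⟨z, ⟨hz, hzΩ⟩, rfl⟩
      exact ⟨hzΩ, φ.map_target hz⟩
  obtain ⟨t, -, ht, hcov⟩ := hK.elim_finite_subcover_image (b := univ)
    (c := fun p => (chartAt H p).source) (fun p _ => (chartAt H p).open_source)
    fun p _ => mem_iUnion₂.2 ⟨p, mem_univ p, mem_chart_source H p⟩
  have : Ω = ⋃ p ∈ t, Ω ∩ (chartAt H p).source := by
    rw [← inter_iUnion₂]
    exact (inter_eq_left.2 (hΩK.trans hcov)).symm
  rw [this]
  exact isSigmaCompact_biUnion ht.countable fun p _ => hchart p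

theorem exists_compact_exhaustion {X : Type*} [TopologicalSpace X] [LocallyCompactSpace X] {Ω : Set X} (hΩ : IsOpen Ω)
    (hσ : IsSigmaCompact Ω) :
    ∃ K : ℕ → Set X, Monotone K ∧ (∀ j, IsCompact (K j)) ∧ (∀ j, K j ⊆ Ω) ∧
      ∀ x ∈ Ω, ∃ j, K j ∈ 𝓝 x := by
  have := isSigmaCompact_iff_sigmaCompactSpace.1 hσ
  have := hΩ.locallyCompactSpace
  let K : CompactExhaustion Ω := default
  refine ⟨fun j => Subtype.val '' K j, fun i j hij => image_mono (K.subset hij),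
    fun j => (K.isCompact j).image continuous_subtype_val, fun j => Subtype.coe_image_subset _ _,
    fun x hx => ?_⟩
  obtain ⟨j, hj⟩ := K.exists_mem_nhds ⟨x, hx⟩
  exact ⟨j, hΩ.isOpenEmbedding_subtypeVal.image_mem_nhds.2 hj⟩

end Exhaustion

/-! ### Holomorphically convex domains are domains of holomorphy. -/

section HolomorphicallyConvex

variable {n : ℕ} {X : Type*} [TopologicalSpace X] [ChartedSpace (Fin n → ℂ) X] {Ω : Set X}

theorem HolomorphicOn.const_mul_pow {f : X → ℂ} (hf : HolomorphicOn n f Ω) (hΩ : IsOpen Ω)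
    [IsManifold 𝓘(ℂ, Fin n → ℂ) 1 X] (a b : ℂ) (N : ℕ) :
    HolomorphicOn n (fun x => a * (b * f x) ^ N) Ω := by
  intro x hx
  refine MDifferentiableAt.mdifferentiableWithinAt ?_
  have hφ : (chartAt (Fin n → ℂ) x).MDifferentiable 𝓘(ℂ, Fin n → ℂ) 𝓘(ℂ, Fin n → ℂ) :=
    mdifferentiable_of_mem_atlas (chart_mem_atlas _ x)
  have hxφ := mem_chart_source (Fin n → ℂ) x
  have := (mdifferentiableAt_iff_differentiableAt_comp_symm hφ hxφ).1 (hf.mdifferentiableAt hΩ hx)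
  rw [mdifferentiableAt_iff_differentiableAt_comp_symm hφ hxφ]
  exact ((this.const_mul b).pow N).const_mul a

/-- A point outside the hull of `L` is separated from `L` by holomorphic functions which are
small on `L` and large at the point. -/
theorem exists_small_on_large_at [IsManifold 𝓘(ℂ, Fin n → ℂ) 1 X] (hΩ : IsOpen Ω)
    {L : Set X} (hL : IsCompact L) (hLΩ : L ⊆ Ω) {y : X} (hy : y ∈ Ω) (hyL : y ∉ holHull n Ω L)
    {ε : ℝ} (hε : 0 < ε) (B : ℝ) :
    ∃ f : X → ℂ, HolomorphicOn n f Ω ∧ (∀ x ∈ L, ‖f x‖ ≤ ε) ∧ B < ‖f y‖ := by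
  obtain ⟨f, hf, hfy⟩ : ∃ f : X → ℂ, HolomorphicOn n f Ω ∧
      sSup ((fun y => ‖f y‖) '' L) < ‖f y‖ := by
    by_contra! h
    exact hyL ⟨hy, h⟩
  have hbdd : BddAbove ((fun y => ‖f y‖) '' L) :=
    (hL.image_of_continuousOn (hf.continuousOn.mono hLΩ).norm).bddAbove
  have h0 : 0 ≤ sSup ((fun y => ‖f y‖) '' L) :=
    Real.sSup_nonneg (by rintro _ ⟨x, -, rfl⟩; exact norm_nonneg _)
  -- Dividing by `c` makes `f` at most `1` on `L` and larger than `1` at `y`; high powers then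
  -- separate.
  obtain ⟨c, hc1, hc2⟩ := exists_between hfy
  have hc0 : 0 < c := h0.trans_lt hc1
  have hgt : 1 < c⁻¹ * ‖f y‖ := by
    rw [inv_mul_eq_div]; exact (one_lt_div hc0).2 hc2
  obtain ⟨N, hN⟩ := pow_unbounded_of_one_lt (B / ε) hgt
  have hnorm : ∀ x, ‖(ε : ℂ) * ((c⁻¹ : ℝ) * f x) ^ N‖ = ε * (c⁻¹ * ‖f x‖) ^ N := fun x => by
    rw [norm_mul, norm_pow, norm_mul, Complex.norm_real, Complex.norm_real,
      Real.norm_of_nonneg hε.le, Real.norm_of_nonneg (inv_nonneg.2 hc0.le)]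
  refine ⟨fun x => (ε : ℂ) * ((c⁻¹ : ℝ) * f x) ^ N, hf.const_mul_pow hΩ _ _ N, fun x hx => ?_, ?_⟩
  · rw [hnorm]
    have hx1 : c⁻¹ * ‖f x‖ ≤ 1 := by
      rw [inv_mul_eq_div, div_le_one hc0]
      exact (le_csSup hbdd ⟨x, hx, rfl⟩).trans hc1.le
    exact mul_le_of_le_one_right hε.le (pow_le_one₀ (by positivity) hx1)
  · rw [hnorm]
    rwa [div_lt_iff₀' hε] at hN

/-- A series of holomorphic functions that is dominated on each member of a compact exhaustion,
up to finitely many terms, has a holomorphic sum. -/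
theorem holomorphicOn_tsum [IsManifold 𝓘(ℂ, Fin n → ℂ) 1 X] (hΩ : IsOpen Ω) {K : ℕ → Set X}
    (hKc : ∀ j, IsCompact (K j)) (hKΩ : ∀ j, K j ⊆ Ω) (hK : ∀ x ∈ Ω, ∃ j, K j ∈ 𝓝 x)
    {f : ℕ → X → ℂ} (hf : ∀ j, HolomorphicOn n (f j) Ω) {u : ℕ → ℝ} (hu : Summable u)
    (hfu : ∀ i j, i ≤ j → ∀ x ∈ K i, ‖f j x‖ ≤ u j) :
    HolomorphicOn n (fun x => ∑' j, f j x) Ω := by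
  intro x hx
  refine MDifferentiableAt.mdifferentiableWithinAt ?_
  obtain ⟨i, hi⟩ := hK x hx
  set φ := chartAt (Fin n → ℂ) x
  have hφ : φ.MDifferentiable 𝓘(ℂ, Fin n → ℂ) 𝓘(ℂ, Fin n → ℂ) :=
    mdifferentiable_of_mem_atlas (chart_mem_atlas _ x)
  have hxφ : x ∈ φ.source := mem_chart_source (Fin n → ℂ) x
  rw [mdifferentiableAt_iff_differentiableAt_comp_symm hφ hxφ]
  obtain ⟨r, hr, hball⟩ := exists_ball_subset_chart (Φ := φ) (isOpen_interior (s := K i)) hxφ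
    (mem_interior_iff_mem_nhds.2 hi)
  have hbd : ∀ j, ∃ C, ∀ x ∈ K i, ‖f j x‖ ≤ C := fun j =>
    (hKc i).exists_bound_of_continuousOn ((hf j).continuousOn.mono (hKΩ i))
  choose C hC using hbd
  -- The finitely many terms with `j < i` are bounded by compactness of `K i`.
  refine differentiableAt_tsum_of_norm_le_on_ball hr (u := fun j => if j < i then C j else u j)
    (fun j => ((hf j).differentiableOn_comp_symm hΩ hφ).mono fun z hz =>
      ⟨(hball hz).1, hKΩ i (interior_subset (hball hz).2)⟩) ?_ fun j z hz => ?_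
  · rw [← summable_nat_add_iff i]
    simpa using (summable_nat_add_iff i).2 hu
  · have hzK : φ.symm z ∈ K i := interior_subset (hball hz).2
    split_ifs with hj
    · exact hC j _ hzK
    · exact hfu i j (not_lt.1 hj) _ hzK

/-- In a holomorphically convex open set, a set on which every holomorphic function is bounded is
contained in a compact subset. -/
theorem HolomorphicallyConvex.exists_compact_superset [IsManifold 𝓘(ℂ, Fin n → ℂ) 1 X]
    [LocallyCompactSpace X] (h : HolomorphicallyConvex n Ω) (hΩ : IsOpen Ω)
    (hσ : IsSigmaCompact Ω) {S : Set X} (hSΩ : S ⊆ Ω)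
    (hS : ∀ f : X → ℂ, HolomorphicOn n f Ω → ∃ C, ∀ x ∈ S, ‖f x‖ ≤ C) :
    ∃ L, IsCompact L ∧ L ⊆ Ω ∧ S ⊆ L := by
  by_contra hcon
  obtain ⟨K, hKm, hKc, hKΩ, hK⟩ := exists_compact_exhaustion hΩ hσ
  have step : ∀ (L : Set X) (B ε : ℝ), IsCompact L → L ⊆ Ω → 0 < ε →
      ∃ (y : X) (f : X → ℂ), y ∈ S ∧ HolomorphicOn n f Ω ∧ (∀ x ∈ L, ‖f x‖ ≤ ε) ∧ B < ‖f y‖ := by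
    intro L B ε hL hLΩ hε
    obtain ⟨hc, hcΩ⟩ := h L hL hLΩ
    obtain ⟨y, hyS, hy⟩ := not_subset.1 fun hsub => hcon ⟨_, hc, hcΩ, hsub⟩
    obtain ⟨f, hf⟩ := exists_small_on_large_at hΩ hL hLΩ (hSΩ hyS)
      (fun hy' => hy (subset_closure hy')) hε B
    exact ⟨y, f, hyS, hf⟩
  have : Nonempty X := by
    obtain ⟨x, -⟩ := nonempty_iff_ne_empty.2 fun hS0 : S = ∅ =>
      hcon ⟨∅, isCompact_empty, empty_subset _, hS0.subset⟩
    exact ⟨x⟩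
  choose! y f hy hf hfL hfy using step
  choose! C hC using hS
  let ε : ℕ → ℝ := fun j => 1 / 2 / 2 ^ j
  have hε : ∀ j, 0 < ε j := fun j => by positivity
  -- pairs of a compact set and of a bound on `S` for the partial sums
  let st : ℕ → Set X × ℝ := fun j => Nat.rec (K 0, 0) (fun j p =>
    (insert (y p.1 (p.2 + j + 1) (ε j)) (p.1 ∪ K (j + 1)),
      p.2 + C (f p.1 (p.2 + j + 1) (ε j)))) j
  -- `F j` is at most `ε j` on the current compact set, while at `Y j` it exceeds the bound on the
  -- earlier partial sums by `j + 1`. The next compact set absorbs `Y j`, so later terms are small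
  -- there.
  let Y : ℕ → X := fun j => y (st j).1 ((st j).2 + j + 1) (ε j)
  let F : ℕ → X → ℂ := fun j => f (st j).1 ((st j).2 + j + 1) (ε j)
  have hst1 : ∀ j, (st (j + 1)).1 = insert (Y j) ((st j).1 ∪ K (j + 1)) := fun j => rfl
  have hst2 : ∀ j, (st (j + 1)).2 = (st j).2 + C (F j) := fun j => rfl
  have hinv : ∀ j, IsCompact (st j).1 ∧ (st j).1 ⊆ Ω ∧ K j ⊆ (st j).1 := by
    intro j
    induction j with
    | zero => exact ⟨hKc 0, hKΩ 0, Subset.rfl⟩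
    | succ j ih =>
      obtain ⟨h1, h2, -⟩ := ih
      rw [hst1]
      exact ⟨(h1.union (hKc _)).insert _, insert_subset (hSΩ (hy _ _ _ h1 h2 (hε j)))
        (union_subset h2 (hKΩ _)), subset_union_right.trans (subset_insert _ _)⟩
  have hYS : ∀ j, Y j ∈ S := fun j => hy _ _ _ (hinv j).1 (hinv j).2.1 (hε j)
  have hF : ∀ j, HolomorphicOn n (F j) Ω := fun j => hf _ _ _ (hinv j).1 (hinv j).2.1 (hε j)
  have hFL : ∀ j, ∀ x ∈ (st j).1, ‖F j x‖ ≤ ε j := fun j =>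
    hfL _ _ _ (hinv j).1 (hinv j).2.1 (hε j)
  have hFY : ∀ j, (st j).2 + j + 1 < ‖F j (Y j)‖ := fun j =>
    hfy _ _ _ (hinv j).1 (hinv j).2.1 (hε j)
  have hmono : Monotone fun j => (st j).1 := monotone_nat_of_le_succ fun j => by
    rw [hst1]
    exact subset_union_left.trans (subset_insert _ _)
  have hYmem : ∀ i j, i < j → Y i ∈ (st j).1 := fun i j hij =>
    hmono (Nat.succ_le_of_lt hij) (show Y i ∈ (st (i + 1)).1 by rw [hst1]; exact mem_insert _ _)
  have hpart : ∀ j, ∀ x ∈ S, ‖∑ i ∈ Finset.range j, F i x‖ ≤ (st j).2 := by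
    intro j x hx
    induction j with
    | zero => simp [st]
    | succ j ih =>
      rw [Finset.sum_range_succ, hst2]
      exact (norm_add_le _ _).trans (add_le_add ih (hC _ (hF j) x hx))
  have hεsum : HasSum ε 1 := hasSum_geometric_two' 1
  have hG := holomorphicOn_tsum hΩ hKc hKΩ hK hF hεsum.summable fun i j hij x hx =>
    hFL j x ((hinv j).2.2 (hKm hij hx))
  obtain ⟨j, hj⟩ := exists_nat_gt (C fun x => ∑' j, F j x)
  -- `Y j` lies in the compact sets from index `j + 1` on, so the tail at `Y j` is at most `∑ ε i =
  -- 1`.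
  have htail : ∀ i, ‖F (i + (j + 1)) (Y j)‖ ≤ ε i := fun i =>
    (hFL (i + (j + 1)) _ (hYmem j (i + (j + 1)) (by omega))).trans (by
      simp only [ε]
      gcongr
      · norm_num
      · exact Nat.le_add_right _ _)
  have hsum : Summable fun i => F i (Y j) :=
    (summable_nat_add_iff (j + 1)).1 (Summable.of_norm_bounded hεsum.summable htail)
  have htail' := tsum_of_norm_bounded hεsum htail
  have hsplit := hsum.sum_add_tsum_nat_add (j + 1)
  rw [Finset.sum_range_succ] at hsplit
  have hle := hC _ hG (Y j) (hYS j)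
  have hFeq : F j (Y j) = (∑' i, F i (Y j)) - ∑ i ∈ Finset.range j, F i (Y j) -
      ∑' i, F (i + (j + 1)) (Y j) := by
    rw [← hsplit]; ring
  have hbound : ‖F j (Y j)‖ ≤ ‖∑' i, F i (Y j)‖ + ‖∑ i ∈ Finset.range j, F i (Y j)‖ +
      ‖∑' i, F (i + (j + 1)) (Y j)‖ := by
    conv_lhs => rw [hFeq]
    exact (norm_sub_le _ _).trans (add_le_add_left (norm_sub_le _ _) _)
  -- The summand `1` absorbs the tail, leaving `j` below the bound of the full sum on `S`, against
  -- the choice of `j`.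
  linarith [hFY j, hpart j (Y j) (hYS j)]

theorem HolomorphicallyConvex.isDomainOfHolomorphy [IsManifold 𝓘(ℂ, Fin n → ℂ) 1 X] [T2Space X]
    (h : HolomorphicallyConvex n Ω) (hΩ : IsOpen Ω) (hc : IsCompact (closure Ω)) :
    IsDomainOfHolomorphy n Ω := by
  have : LocallyCompactSpace X := ChartedSpace.locallyCompactSpace (Fin n → ℂ) X
  have : LocallyConnectedSpace X := ChartedSpace.locallyConnectedSpace (Fin n → ℂ) X
  unfold IsDomainOfHolomorphy
  rintro ⟨b, hb, U, V, hU, hUc, hbU, hV, ⟨v, hv⟩, hVsub, hext⟩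
  have hbΩ : b ∉ Ω := fun hb' => hb.2 (by rwa [hΩ.interior_eq])
  set W := connectedComponentIn (U ∩ Ω) v with hW
  have hWo : IsOpen W := (hU.inter hΩ).connectedComponentIn
  have hWc : IsPreconnected W := isPreconnected_connectedComponentIn
  have hWsub : W ⊆ U ∩ Ω := connectedComponentIn_subset _ _
  have hvW : v ∈ W := mem_connectedComponentIn (hVsub hv)
  -- Otherwise each limit point of `W` in `U` lies in `U ∩ Ω`, hence in the component `W`. Then `W`
  -- is closed in the connected `U`, so `b ∈ W ⊆ Ω`.
  obtain ⟨c, hcW, hcU, hcΩ⟩ : ∃ c ∈ closure W, c ∈ U ∧ c ∉ Ω := by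
    by_contra! hcon
    refine hbΩ (hWsub (hUc.isPreconnected.subset_of_closure_inter_subset hWo
      ⟨v, (hWsub hvW).1, hvW⟩ ?_ hbU)).2
    rintro c ⟨hcW, hcU⟩
    have hpre : IsPreconnected (insert c W) :=
      hWc.subset_closure (subset_insert c W) (insert_subset hcW subset_closure)
    exact hpre.subset_connectedComponentIn (mem_insert_of_mem c hvW)
      (insert_subset (show c ∈ U ∩ Ω from ⟨hcU, hcon c hcW hcU⟩) hWsub) (mem_insert c W)
  obtain ⟨N, hN, hNU, hNc⟩ := local_compact_nhds (hU.mem_nhds hcU)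
  obtain ⟨L, hL, hLΩ, hSL⟩ := h.exists_compact_superset hΩ
    (isSigmaCompact_of_isOpen_of_isCompact (Fin n → ℂ) hΩ hc subset_closure) (S := W ∩ N)
    (fun x hx => (hWsub hx.1).2) fun f hf => by
      obtain ⟨g, hg, hfg⟩ := hext f hf
      obtain ⟨C, hC⟩ := hNc.exists_bound_of_continuousOn (hg.continuousOn.mono hNU)
      have hEq : EqOn f g W := HolomorphicOn.eqOn_of_isPreconnected
        (hf.mono fun x hx => (hWsub hx).2) (hg.mono fun x hx => (hWsub hx).1) hWo hWc hV
        ⟨v, hvW, hv⟩ hfg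
      exact ⟨C, fun x hx => by rw [hEq hx.1]; exact hC x hx.2⟩
  have hcS : c ∈ closure (W ∩ N) := by
    rw [mem_closure_iff_nhds] at hcW ⊢
    intro t ht
    obtain ⟨x, ⟨hxt, hxN⟩, hxW⟩ := hcW _ (inter_mem ht hN)
    exact ⟨x, hxt, hxW, hxN⟩
  -- Compact sets are closed in the Hausdorff space `X`, so `L` contains the limit point `c`.
  exact hcΩ (hLΩ (closure_minimal hSL hL.isClosed hcS))

end HolomorphicallyConvex

end CartanThullen

theorem corollary1p3 {n : ℕ} {X : Type*} [TopologicalSpace X] [T2Space X]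
    [ChartedSpace (Fin n → ℂ) X] [IsManifold 𝓘(ℂ, Fin n → ℂ) ω X]
    (hA : CartanThullen.CondA n X)
    (Ω : Set X) (hΩ_open : IsOpen Ω) (hΩ_conn : IsConnected Ω)
    (hΩ : CartanThullen.RelCompactIn Ω univ) :
    CartanThullen.IsDomainOfHolomorphy n Ω ↔ CartanThullen.HolomorphicallyConvex n Ω := by
  obtain ⟨A, hA'⟩ := hA.exists_hasFlatCharts
  exact ⟨fun h => h.holomorphicallyConvex hA' hΩ_open hΩ.1,
    fun h => h.isDomainOfHolomorphy hΩ_open hΩ.1⟩
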